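/- Call a real matrix totally positive (TP) if all its minors are positive, totally nonnegative (TN) if all its minors are nonnegative, and call a square matrix $A$ oscillatory if it is TN and $A^k$ is TP for some integer $k\ge 1$. For $A:\mathbb N\to\mathbb R^{n\times n}$ (with $\mathbb N=\{0,1,2,\dots\}$) and an integer $p\ge 1$, the linear system $y(k+1)=A(k)y(k)$ is called an oscillatory discrete-time system (ODTS) of order $p$ if $A(k)$ is oscillatory for all $k\in\mathbb N$ and every product $A(k_p)\cdots A(k_2)A(k_1)$ with $0\le k_1<k_2<\dots<k_p$ is TP. Let $f_1,\dots,f_n:\mathbb R\to\mathbb R$ be $C^1$ functions with $f_i'(y)>0$ for all $i$ and all $y\in\mathbb R$, let $C:\mathbb N\to\mathbb R^{n\times n}$, and consider the time-varying nonlinear system $$x(k+1)=C(k)\begin{bmatrix} f_1(x_1(k))\\ \vdots\\ f_n(x_n(k))\end{bmatrix},\qquad k\in\mathbb N. \tag{1}$$ Suppose that the trajectories of (1) evolve on a compact and convex set $\Omega\subset\mathbb R^n$ (that is, every solution of (1) with $x(0)\in\Omega$ satisfies $x(k)\in\Omega$ for all $k\in\mathbb N$), and that $C$ is $T$-periodic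 for some integer $T\ge 1$, i.e. $C(k+T)=C(k)$ for all $k\in\mathbb N$. If $z(k+1)=C(k)z(k)$ is an ODTS of order $h$, then every solution $x$ of (1) with $x(0)\in\Omega$ converges to an $hT$-periodic solution of (1): there is a solution $y$ of (1) with $y(k)\in\Omega$ and $y(k+hT)=y(k)$ for all $k\in\mathbb N$, such that $\lim_{k\to\infty}(x(k)-y(k))=0$. -/

import Mathlib

open Filter Topology Matrix

/-- A real matrix is totally positive (TP) if all its minors are positive. (The `r = 0` minor is the
determinant of the empty matrix, which is `1`, so it imposes nothing.) -/
def IsTotallyPositive {m n : ℕ} (A : Matrix (Fin m) (Fin n) ℝ) : Prop :=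
  ∀ (r : ℕ) (α : Fin r → Fin m) (β : Fin r → Fin n), StrictMono α → StrictMono β →
    0 < (A.submatrix α β).det

/-- A real matrix is totally nonnegative (TN) if all its minors are nonnegative. -/
def IsTotallyNonnegative {m n : ℕ} (A : Matrix (Fin m) (Fin n) ℝ) : Prop :=
  ∀ (r : ℕ) (α : Fin r → Fin m) (β : Fin r → Fin n), StrictMono α → StrictMono β →
    0 ≤ (A.submatrix α β).det

/-- A square matrix is oscillatory if it is TN and some positive power of it is TP. -/
def IsOscillatory {n : ℕ} (A : Matrix (Fin n) (Fin n) ℝ) : Prop :=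
  IsTotallyNonnegative A ∧ ∃ k : ℕ, 0 < k ∧ IsTotallyPositive (A ^ k)

/-- The linear time-varying system `y (k + 1) = A k y k` is an oscillatory discrete-time system
(ODTS) of order `p`: every `A k` is oscillatory and, for all times `κ 0 < κ 1 < ⋯ < κ (p - 1)`,
the product `A (κ (p - 1)) * ⋯ * A (κ 1) * A (κ 0)` is TP. -/
def IsODTS {n : ℕ} (A : ℕ → Matrix (Fin n) (Fin n) ℝ) (p : ℕ) : Prop :=
  0 < p ∧ (∀ k, IsOscillatory (A k)) ∧
    ∀ κ : Fin p → ℕ, StrictMono κ →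
      IsTotallyPositive (List.ofFn fun i : Fin p => A (κ i)).reverse.prod

/-- `x` solves `x (k + 1) = C k (f₁ (x₁ k), …, fₙ (xₙ k))` for all times `k`. -/
def IsSolution {n : ℕ} (C : ℕ → Matrix (Fin n) (Fin n) ℝ) (f : Fin n → ℝ → ℝ)
    (x : ℕ → Fin n → ℝ) : Prop :=
  ∀ k, x (k + 1) = C k *ᵥ fun i => f i (x k i)

/-! The difference of two solutions solves a linear system with matrices `C k * diagonal (d k)`, `d
k` positive. By Cauchy–Binet, products over `h` consecutive steps stay TP under this rescaling. A TP
matrix cannot lengthen sign alternations with a prescribed leading sign, so along the sampled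
difference both alternation numbers (leading `+`, leading `-`) decrease and freeze; comparing the
frozen values fixes the sign of the first coordinate. Hence two distinct solutions are eventually
strictly ordered in their first coordinates at multiples of `h` (`IsODTS.eventually_lt_or_gt`).

Comparing a solution with its shift by `N = h * T` shows that its first coordinate at times `N * k`
is eventually monotone, hence convergent. Trajectories from cluster points of `x (N * k)` then all
share one first coordinate at multiples of `N`, so the ordering allows only one cluster point. By
compactness `x (N * k)` converges, and the period map fixes the limit. -/

/-! ### Minors of products and column rescaling -/

/-- The **Cauchy–Binet formula** for minors of a product. -/
theorem det_submatrix_mul {l m n r : ℕ} (A : Matrix (Fin l) (Fin m) ℝ)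
    (B : Matrix (Fin m) (Fin n) ℝ) (α : Fin r → Fin l) (β : Fin r → Fin n) :
    ((A * B).submatrix α β).det =
      ∑ γ : {γ : Fin r → Fin m // StrictMono γ},
        (A.submatrix α γ).det * (B.submatrix γ β).det := by
  classical
  have expand : ((A * B).submatrix α β).det =
      ∑ p : Fin r → Fin m, (A.submatrix α p).det * ∏ i, B (p i) (β i) := by
    rw [← det_transpose]
    have hrow : ((A * B).submatrix α β)ᵀ =
        fun i => ∑ k, B k (β i) • (fun j => A (α j) k) := by
      ext i j
      simp [Matrix.mul_apply, Finset.sum_apply, mul_comm]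
    rw [hrow]
    change (detRowAlternating : (Fin r → ℝ) [⋀^Fin r]→ₗ[ℝ] ℝ).toMultilinearMap _ = _
    rw [MultilinearMap.map_sum]
    refine Finset.sum_congr rfl fun p _ => ?_
    rw [MultilinearMap.map_smul_univ, smul_eq_mul, mul_comm]
    congr 1
    rw [← det_transpose (A.submatrix α p)]
    rfl
  rw [expand]
  have regroup : ∀ γ : {γ : Fin r → Fin m // StrictMono γ},
      (A.submatrix α γ).det * (B.submatrix γ β).det =
        ∑ σ : Equiv.Perm (Fin r),
          (A.submatrix α (γ.1 ∘ σ)).det * ∏ i, B ((γ.1 ∘ σ) i) (β i) := by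
    intro γ
    rw [det_apply' (B.submatrix γ β), Finset.mul_sum]
    refine Finset.sum_congr rfl fun σ _ => ?_
    have := det_permute' σ (A.submatrix α γ.1)
    rw [submatrix_submatrix] at this
    simp only [Function.comp_id] at this
    rw [this]
    simp only [submatrix_apply, Function.comp_apply]
    ring
  rw [Finset.sum_congr rfl fun γ _ => regroup γ, ← Fintype.sum_prod_type'
    (f := fun (γ : {γ : Fin r → Fin m // StrictMono γ}) (σ : Equiv.Perm (Fin r)) =>
      (A.submatrix α (γ.1 ∘ σ)).det * ∏ i, B ((γ.1 ∘ σ) i) (β i))]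
  symm
  -- Injective `p` factor uniquely as `γ ∘ σ`, by sorting; any other `p` repeats a column and
  -- contributes zero.
  refine Finset.sum_of_injOn (fun q => q.1.1 ∘ q.2) ?_ (fun _ _ => Finset.mem_univ _) ?_
    (fun _ _ => rfl)
  · rintro ⟨⟨γ, hγ⟩, σ⟩ - ⟨⟨γ', hγ'⟩, σ'⟩ - heq
    simp only at heq
    have hr : Set.range γ = Set.range γ' := by
      rw [← σ.surjective.range_comp γ, heq, σ'.surjective.range_comp γ']
    obtain rfl : γ = γ' := (StrictMono.range_inj hγ hγ').1 hr
    have : σ = σ' := Equiv.ext fun i => hγ.injective (congrFun heq i)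
    rw [this]
  · intro p _ hp
    by_cases hinj : Function.Injective p
    · refine absurd ?_ hp
      refine ⟨(⟨p ∘ Tuple.sort p, (Tuple.monotone_sort p).strictMono_of_injective
        (hinj.comp (Tuple.sort p).injective)⟩, (Tuple.sort p)⁻¹), by simp, ?_⟩
      ext i
      simp
    · rw [Function.Injective] at hinj
      push Not at hinj
      obtain ⟨i, j, hij, hne⟩ := hinj
      rw [det_zero_of_column_eq hne (fun k => by simp [hij]), zero_mul]

/-- Minors of a matrix whose columns have been rescaled. -/
theorem det_submatrix_mul_diagonal {m n r : ℕ} (A : Matrix (Fin m) (Fin n) ℝ) (d : Fin n → ℝ)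
    (α : Fin r → Fin m) (β : Fin r → Fin n) :
    ((A * diagonal d).submatrix α β).det = (A.submatrix α β).det * ∏ i, d (β i) := by
  have : (A * diagonal d).submatrix α β = A.submatrix α β * diagonal (d ∘ β) := by
    ext i j
    simp [mul_diagonal]
  rw [this, det_mul, det_diagonal]
  rfl

/-- Rescaling the columns of the factors of a product of TN matrices by positive numbers keeps the
product TN and keeps its positive minors positive. -/
theorem minors_prod_mul_diagonal {n : ℕ} (A : ℕ → Matrix (Fin n) (Fin n) ℝ)
    (d : ℕ → Fin n → ℝ) (hA : ∀ k, IsTotallyNonnegative (A k)) (hd : ∀ k i, 0 < d k i)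
    (p : ℕ) {r : ℕ} (α β : Fin r → Fin n) (hα : StrictMono α) (hβ : StrictMono β) :
    0 ≤ ((List.ofFn fun i : Fin p => A i).reverse.prod.submatrix α β).det ∧
    0 ≤ ((List.ofFn fun i : Fin p => A i * diagonal (d i)).reverse.prod.submatrix α β).det ∧
    (0 < ((List.ofFn fun i : Fin p => A i).reverse.prod.submatrix α β).det →
      0 < ((List.ofFn fun i : Fin p => A i * diagonal (d i)).reverse.prod.submatrix α β).det) := by
  induction p generalizing α with
  | zero =>
    have key : 0 ≤ ((1 : Matrix (Fin n) (Fin n) ℝ).submatrix α β).det := by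
      have htri : ((1 : Matrix (Fin n) (Fin n) ℝ).submatrix α β).det =
          if α = β then 1 else 0 := by
        split_ifs with h
        · subst h
          rw [submatrix_one _ hα.injective, det_one]
        · have : ∃ i, ∀ j, α i ≠ β j := by
            by_contra! hcon
            have hsub : Set.range α ⊆ Set.range β := by
              rintro _ ⟨i, rfl⟩
              obtain ⟨j, hj⟩ := hcon i
              exact ⟨j, hj.symm⟩
            have hrange : Set.range α = Set.range β := by
              refine Set.eq_of_subset_of_ncard_le hsub ?_ (Set.toFinite _)
              rw [Set.ncard_range_of_injective hα.injective,
                Set.ncard_range_of_injective hβ.injective]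
            exact h ((StrictMono.range_inj hα hβ).1 hrange)
          obtain ⟨i, hi⟩ := this
          exact det_eq_zero_of_row_eq_zero i fun j => by simp [hi j]
      rw [htri]
      split_ifs <;> norm_num
    simpa using key
  | succ p ih =>
    simp only [List.ofFn_succ_last, List.reverse_append, List.reverse_cons, List.reverse_nil,
      List.nil_append, List.prod_append, List.prod_cons, List.prod_nil, mul_one, Fin.val_last,
      Fin.val_castSucc]
    rw [det_submatrix_mul (A p), det_submatrix_mul (A p * diagonal (d p))]
    simp only [det_submatrix_mul_diagonal]
    have hpos : ∀ γ : Fin r → Fin n, 0 < ∏ i, d p (γ i) := fun γ =>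
      Finset.prod_pos fun i _ => hd p _
    have hterm : ∀ γ : {γ : Fin r → Fin n // StrictMono γ}, 0 ≤
        ((A p).submatrix α γ).det * (∏ i, d p (γ.1 i)) *
        ((List.ofFn fun i : Fin p => A i * diagonal (d i)).reverse.prod.submatrix γ β).det :=
      fun γ => mul_nonneg (mul_nonneg (hA p r α γ hα γ.2) (hpos _).le) (ih γ γ.2).2.1
    refine ⟨Finset.sum_nonneg fun γ _ => mul_nonneg (hA p r α γ hα γ.2) (ih γ γ.2).1,
      Finset.sum_nonneg fun γ _ => hterm γ, fun h => ?_⟩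
    obtain ⟨γ, -, hγ⟩ := Finset.exists_lt_of_sum_lt (f := fun _ => (0 : ℝ)) (by simpa using h)
    have h1 := hA p r α γ hα γ.2
    have h2 := (ih γ γ.2).1
    refine Finset.sum_pos' (fun γ _ => hterm γ) ⟨γ, Finset.mem_univ _, ?_⟩
    exact mul_pos (mul_pos (pos_of_mul_pos_left hγ h2) (hpos _))
      ((ih γ γ.2).2.2 (pos_of_mul_pos_right hγ h1))

/-- Rescaling the columns of the factors of a TP product of TN matrices by positive numbers gives a
TP product. -/
theorem IsTotallyPositive.prod_mul_diagonal {n : ℕ} (A : ℕ → Matrix (Fin n) (Fin n) ℝ)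
    (d : ℕ → Fin n → ℝ) (hA : ∀ k, IsTotallyNonnegative (A k)) (hd : ∀ k i, 0 < d k i)
    (p : ℕ) (h : IsTotallyPositive (List.ofFn fun i : Fin p => A i).reverse.prod) :
    IsTotallyPositive (List.ofFn fun i : Fin p => A i * diagonal (d i)).reverse.prod :=
  fun _ α β hα hβ => (minors_prod_mul_diagonal A d hA hd p α β hα hβ).2.2 (h _ α β hα hβ)

/-- Propagation of a linear time-varying recursion over `p` steps. -/
theorem iterate_mulVec {n : ℕ} (B : ℕ → Matrix (Fin n) (Fin n) ℝ) (z : ℕ → Fin n → ℝ)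
    (hz : ∀ k, z (k + 1) = B k *ᵥ z k) (p : ℕ) :
    z p = (List.ofFn fun i : Fin p => B i).reverse.prod *ᵥ z 0 := by
  induction p with
  | zero => simp
  | succ p ih =>
    simp only [List.ofFn_succ_last, List.reverse_append, List.reverse_cons, List.reverse_nil,
      List.nil_append, List.prod_append, List.prod_cons, List.prod_nil, mul_one, Fin.val_last,
      Fin.val_castSucc]
    rw [← mulVec_mulVec, ← ih, hz]

/-! ### Sign alternations and variation diminishing -/

/-- `z` has a subsequence of length `r` whose signs alternate strictly, starting with that
of `ε`. -/
def HasStrictAlternation {n : ℕ} (ε : ℝ) (z : Fin n → ℝ) (r : ℕ) : Prop :=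
  ∃ κ : Fin r → Fin n, StrictMono κ ∧ ∀ j : Fin r, 0 < ε * (-1) ^ (j : ℕ) * z (κ j)

/-- `z` has a subsequence of length `r` whose signs alternate, starting with that of `ε`, where
zero entries may be given either sign. -/
def HasWeakAlternation {n : ℕ} (ε : ℝ) (z : Fin n → ℝ) (r : ℕ) : Prop :=
  ∃ κ : Fin r → Fin n, StrictMono κ ∧ ∀ j : Fin r, 0 ≤ ε * (-1) ^ (j : ℕ) * z (κ j)

theorem HasStrictAlternation.weak {n : ℕ} {ε : ℝ} {z : Fin n → ℝ} {r : ℕ}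
    (h : HasStrictAlternation ε z r) : HasWeakAlternation ε z r :=
  let ⟨κ, hκ, hz⟩ := h
  ⟨κ, hκ, fun j => (hz j).le⟩

theorem hasStrictAlternation_zero {n : ℕ} (ε : ℝ) (z : Fin n → ℝ) :
    HasStrictAlternation ε z 0 :=
  ⟨Fin.elim0, fun i => i.elim0, fun i => i.elim0⟩

theorem HasStrictAlternation.le {n : ℕ} {ε : ℝ} {z : Fin n → ℝ} {r : ℕ}
    (h : HasStrictAlternation ε z r) : r ≤ n := by
  obtain ⟨κ, hκ, -⟩ := h
  simpa using Fintype.card_le_of_injective κ hκ.injective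

/-- An index outside the range of an increasing tuple can be inserted into it. -/
theorem exists_strictMono_insertNth {m n : ℕ} (κ : Fin m → Fin n) (hκ : StrictMono κ) (k : Fin n)
    (hk : k ∉ Set.range κ) :
    ∃ p : Fin (m + 1), StrictMono (p.insertNth (α := fun _ => Fin n) k κ) := by
  -- The insertion position is the number of entries of `κ` below `k`.
  classical
  have hcard : (Finset.univ.filter fun l => κ l < k).card < m + 1 :=
    Nat.lt_succ_of_le (by simpa using Finset.card_le_univ (Finset.univ.filter fun l => κ l < k))
  refine ⟨⟨_, hcard⟩, (Fin.strictMono_insertNth_iff _ _ _).2 ⟨hκ, fun i hi => ?_, fun i hi => ?_⟩⟩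
  · by_contra hcon
    have hsub : (Finset.univ.filter fun l => κ l < k) ⊆ Finset.Iio i := by
      intro l hl
      simp only [Finset.mem_filter, Finset.mem_univ, true_and] at hl
      exact Finset.mem_Iio.2 (hκ.lt_iff_lt.1 (hl.trans_le (not_lt.1 hcon)))
    have := Finset.card_le_card hsub
    rw [Fin.card_Iio] at this
    rw [Fin.lt_def] at hi
    simp only [Fin.val_castSucc] at hi
    omega
  · by_contra hcon
    have hne : κ i ≠ k := fun h => hk ⟨i, h⟩
    have hlt : κ i < k := lt_of_le_of_ne (not_lt.1 hcon) hne
    have hsub : Finset.Iic i ⊆ Finset.univ.filter fun l => κ l < k := by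
      intro l hl
      simp only [Finset.mem_filter, Finset.mem_univ, true_and]
      exact (hκ.monotone (Finset.mem_Iic.1 hl)).trans_lt hlt
    have := Finset.card_le_card hsub
    rw [Fin.card_Iic] at this
    rw [Fin.le_def] at hi
    simp only [Fin.val_castSucc] at hi
    omega

/-- If `m` is the maximal length of a strict alternation of `z`, then there are `m` nodes such that
`z` has, away from the nodes, (weakly) opposite signs in consecutive gaps between them. -/
theorem HasStrictAlternation.exists_nodes {m n : ℕ} {ε : ℝ} {z : Fin n → ℝ}
    (h : HasStrictAlternation ε z m) (h' : ¬ HasStrictAlternation ε z (m + 1)) :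
    ∃ κ : Fin m → Fin n, StrictMono κ ∧ ∀ (k : Fin n) (p : Fin (m + 1)),
      StrictMono (p.insertNth (α := fun _ => Fin n) k κ) → ε * (-1) ^ (p : ℕ) * z k ≤ 0 := by
  classical
  -- Choose the leftmost alternation, by minimal index sum. An offending `k` in the last gap would
  -- extend it; in an earlier gap it could replace the next node and lower the sum.
  obtain ⟨κ, ⟨hκ, hz⟩, hmin⟩ := Set.exists_min_image
    {κ : Fin m → Fin n | StrictMono κ ∧ ∀ j : Fin m, 0 < ε * (-1) ^ (j : ℕ) * z (κ j)}
    (fun κ => ∑ i, (κ i : ℕ)) (Set.toFinite _) h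
  refine ⟨κ, hκ, fun k p hp => ?_⟩
  by_contra! hpos
  obtain ⟨l, rfl⟩ | rfl := p.eq_castSucc_or_eq_last; swap
  · refine h' ⟨_, hp, fun j => ?_⟩
    obtain ⟨i, rfl⟩ | rfl := j.eq_castSucc_or_eq_last; swap
    · simpa using hpos
    · simpa using hz i
  · have hlt : k < κ l := ((Fin.strictMono_insertNth_iff _ _ _).1 hp).2.2 l le_rfl
    have hupd : Function.update κ l k =
        (l.castSucc.insertNth (α := fun _ => Fin n) k κ) ∘ l.succ.succAbove := by
      ext i
      rcases lt_trichotomy i l with hi | rfl | hi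
      · rw [Function.update_of_ne hi.ne, Function.comp_apply,
          Fin.succAbove_of_castSucc_lt _ _ (Fin.castSucc_lt_succ_iff.2 hi.le),
          ← Fin.succAbove_of_castSucc_lt l.castSucc i (by simpa using hi),
          Fin.insertNth_apply_succAbove]
      · rw [Function.update_self, Function.comp_apply,
          Fin.succAbove_of_castSucc_lt _ _ Fin.castSucc_lt_succ, Fin.insertNth_apply_same]
      · rw [Function.update_of_ne hi.ne', Function.comp_apply,
          Fin.succAbove_of_le_castSucc _ _ (Fin.succ_le_castSucc_iff.2 hi),
          ← Fin.succAbove_of_le_castSucc l.castSucc i (by simpa using hi.le),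
          Fin.insertNth_apply_succAbove]
    have hmem : Function.update κ l k ∈
        {κ : Fin m → Fin n | StrictMono κ ∧ ∀ j : Fin m, 0 < ε * (-1) ^ (j : ℕ) * z (κ j)} := by
      refine ⟨hupd ▸ hp.comp (Fin.strictMono_succAbove _), fun j => ?_⟩
      by_cases hj : j = l
      · subst hj
        simpa using hpos
      · simpa [hj] using hz j
    refine (hmin _ hmem).not_gt (Finset.sum_lt_sum (fun i _ => ?_) ⟨l, Finset.mem_univ _, ?_⟩)
    · by_cases hi : i = l
      · subst hi
        simpa using hlt.le
      · simp [hi]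
    · simpa using hlt

/-- Laplace expansion: inserting a column at position `p` rather than at the front changes the sign
of the determinant by `(-1) ^ p`. -/
theorem laplace_insertNth {l n m : ℕ} (M : Matrix (Fin l) (Fin n) ℝ) (ρ : Fin (m + 1) → Fin l)
    (κ : Fin m → Fin n) (k : Fin n) (p : Fin (m + 1)) :
    ∑ j : Fin (m + 1), (-1) ^ (j : ℕ) * (M.submatrix (ρ ∘ j.succAbove) κ).det * M (ρ j) k =
      (-1) ^ (p : ℕ) * (M.submatrix ρ (p.insertNth (α := fun _ => Fin n) k κ)).det := by
  rw [det_succ_column _ p, Finset.mul_sum]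
  refine Finset.sum_congr rfl fun j _ => ?_
  have hsub : (M.submatrix ρ (p.insertNth (α := fun _ => Fin n) k κ)).submatrix j.succAbove
      p.succAbove = M.submatrix (ρ ∘ j.succAbove) κ := by
    ext a b
    simp
  rw [hsub]
  simp only [submatrix_apply, Fin.insertNth_apply_same]
  have hsq : ((-1 : ℝ) ^ (p : ℕ)) * (-1) ^ (p : ℕ) = 1 := by
    rw [← mul_pow]; norm_num
  rw [pow_add]
  linear_combination (-(((-1) ^ (j : ℕ) * (M.submatrix (ρ ∘ j.succAbove) κ).det * M (ρ j) k))) * hsq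

/-- **Variation diminishing property** of totally positive matrices, with control of the leading
sign. -/
theorem IsTotallyPositive.hasStrictAlternation {l n r : ℕ} {M : Matrix (Fin l) (Fin n) ℝ}
    (hM : IsTotallyPositive M) {ε : ℝ} (hε : ε ≠ 0) {z : Fin n → ℝ} (hz : z ≠ 0)
    (h : HasWeakAlternation ε (M *ᵥ z) r) : HasStrictAlternation ε z r := by
  by_contra hr
  obtain ⟨m, hmr, hm, hm'⟩ : ∃ m, m < r ∧ HasStrictAlternation ε z m ∧
      ¬ HasStrictAlternation ε z (m + 1) := by
    by_contra! hcon
    have : ∀ m, m ≤ r → HasStrictAlternation ε z m := by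
      intro m
      induction m with
      | zero => exact fun _ => hasStrictAlternation_zero ε z
      | succ m ih => exact fun hm => hcon m hm (ih (by omega))
    exact hr (this r le_rfl)
  obtain ⟨κ, hκ, hnodes⟩ := hm.exists_nodes hm'
  obtain ⟨ι, hι, hw⟩ := h
  set ρ : Fin (m + 1) → Fin l := ι ∘ Fin.castLE hmr with hρ_def
  have hρ : StrictMono ρ := hι.comp (Fin.strictMono_castLE hmr)
  have hwρ : ∀ j : Fin (m + 1), 0 ≤ ε * (-1) ^ (j : ℕ) * (M *ᵥ z) (ρ j) := fun j => hw (Fin.castLE hmr j)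
  set μ : Fin (m + 1) → ℝ := fun j => (M.submatrix (ρ ∘ j.succAbove) κ).det
  have hμ : ∀ j, 0 < μ j := fun j => hM _ _ _ (hρ.comp (Fin.strictMono_succAbove j)) hκ
  -- This combination of rows vanishes at the nodes and has sign `(-1) ^ p` in gap `p`, against the
  -- sign of `ε * z`. Pairing it with `ε * z` gives a sum that is nonpositive termwise, yet
  -- nonnegative by the weak alternation of `M *ᵥ z`; so all terms vanish.
  set D : Fin n → ℝ := fun k => ∑ j : Fin (m + 1), (-1) ^ (j : ℕ) * μ j * M (ρ j) k
  have hDnode : ∀ k, k ∈ Set.range κ → D k = 0 := by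
    rintro _ ⟨i, rfl⟩
    have := laplace_insertNth M ρ κ (κ i) 0
    refine this.trans ?_
    rw [det_zero_of_column_eq (Fin.succ_ne_zero i).symm fun j => by simp, mul_zero]
  have hDgap : ∀ k, k ∉ Set.range κ → D k ≠ 0 ∧ ε * D k * z k ≤ 0 := by
    intro k hk
    obtain ⟨p, hp⟩ := exists_strictMono_insertNth κ hκ k hk
    have hD : D k = (-1) ^ (p : ℕ) *
        (M.submatrix ρ (p.insertNth (α := fun _ => Fin n) k κ)).det :=
      laplace_insertNth M ρ κ k p
    have hdet := hM _ _ _ hρ hp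
    refine ⟨hD ▸ mul_ne_zero (pow_ne_zero _ (by norm_num)) hdet.ne', ?_⟩
    have := mul_nonpos_of_nonpos_of_nonneg (hnodes k p hp) hdet.le
    rw [hD]
    linarith
  have hsum : ∑ j, μ j * (ε * (-1) ^ (j : ℕ) * (M *ᵥ z) (ρ j)) = ∑ k, ε * D k * z k := by
    simp only [D, mulVec, dotProduct, Finset.mul_sum, Finset.sum_mul]
    rw [Finset.sum_comm]
    exact Finset.sum_congr rfl fun k _ => Finset.sum_congr rfl fun j _ => by ring
  have hle : ∀ k, ε * D k * z k ≤ 0 := fun k => by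
    by_cases hk : k ∈ Set.range κ
    · simp [hDnode k hk]
    · exact (hDgap k hk).2
  have hge : ∀ j, 0 ≤ μ j * (ε * (-1) ^ (j : ℕ) * (M *ᵥ z) (ρ j)) := fun j =>
    mul_nonneg (hμ j).le (hwρ j)
  have hzero : ∑ k, ε * D k * z k = 0 :=
    le_antisymm (Finset.sum_nonpos fun k _ => hle k)
      (hsum ▸ Finset.sum_nonneg fun j _ => hge j)
  have hzgap : ∀ k, k ∉ Set.range κ → z k = 0 := fun k hk => by
    have := (Finset.sum_eq_zero_iff_of_nonpos fun k _ => hle k).1 hzero k (Finset.mem_univ _)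
    simpa [hε, (hDgap k hk).1] using this
  have hwzero : ∀ j, (M *ᵥ z) (ρ j) = 0 := fun j => by
    have := (Finset.sum_eq_zero_iff_of_nonneg fun j _ => hge j).1 (hsum.trans hzero) j
      (Finset.mem_univ _)
    simpa [hε, (hμ j).ne'] using this
  -- Now `z` lives on the `m` nodes and `M *ᵥ z` vanishes on the rows `ρ`; a positive `m × m` minor
  -- forces `z = 0`.
  have hzκ : z ∘ κ = 0 := by
    refine eq_zero_of_mulVec_eq_zero (M := M.submatrix (ρ ∘ Fin.castSucc) κ)
      (hM _ _ _ (hρ.comp Fin.strictMono_castSucc) hκ).ne' ?_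
    ext j
    have := hwzero j.castSucc
    rw [mulVec, dotProduct,
      ← Finset.sum_subset (Finset.subset_univ (Finset.univ.map ⟨κ, hκ.injective⟩))
        (fun k _ hk => by rw [hzgap k (by simpa using hk), mul_zero]), Finset.sum_map] at this
    simpa [mulVec, dotProduct] using this
  refine hz (funext fun k => ?_)
  by_cases hk : k ∈ Set.range κ
  · obtain ⟨i, rfl⟩ := hk
    exact congrFun hzκ i
  · exact hzgap k hk

/-! ### Alternation numbers and the sign of the first coordinate -/

/-- The maximal length of a strict sign alternation of `z` starting with the sign of `ε`. -/
noncomputable def alternationNumber {n : ℕ} (ε : ℝ) (z : Fin n → ℝ) : ℕ :=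
  open Classical in Nat.findGreatest (HasStrictAlternation ε z) n

theorem hasStrictAlternation_alternationNumber {n : ℕ} (ε : ℝ) (z : Fin n → ℝ) :
    HasStrictAlternation ε z (alternationNumber ε z) :=
  open Classical in Nat.findGreatest_spec (Nat.zero_le _) (hasStrictAlternation_zero ε z)

theorem HasStrictAlternation.le_alternationNumber {n : ℕ} {ε : ℝ} {z : Fin n → ℝ} {r : ℕ}
    (h : HasStrictAlternation ε z r) : r ≤ alternationNumber ε z :=
  open Classical in Nat.le_findGreatest h.le h

theorem IsTotallyPositive.alternationNumber_le {l n : ℕ} {M : Matrix (Fin l) (Fin n) ℝ}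
    (hM : IsTotallyPositive M) {ε : ℝ} (hε : ε ≠ 0) {z : Fin n → ℝ} (hz : z ≠ 0) :
    alternationNumber ε (M *ᵥ z) ≤ alternationNumber ε z :=
  (hM.hasStrictAlternation hε hz
    (hasStrictAlternation_alternationNumber ε (M *ᵥ z)).weak).le_alternationNumber

/-- Index `0` has the wrong sign to head the alternation, so it precedes all its nodes and can be
prepended. -/
theorem HasStrictAlternation.cons_zero {n : ℕ} {ε : ℝ} {z : Fin (n + 1) → ℝ} {r : ℕ}
    (h : HasStrictAlternation ε z r) (h0 : ε * z 0 ≤ 0) : HasWeakAlternation (-ε) z (r + 1) := by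
  obtain ⟨κ, hκ, hz⟩ := h
  have hpos : ∀ i, 0 < κ i := by
    intro i
    refine Fin.pos_of_ne_zero fun hi => ?_
    have hval : (i : ℕ) = 0 := by
      by_contra hne
      have : κ ⟨0, by omega⟩ < κ i := hκ (Fin.lt_def.2 (Nat.pos_of_ne_zero hne))
      rw [hi] at this
      exact Fin.not_lt_zero _ this
    have := hz i
    rw [hi, hval] at this
    simp only [pow_zero, mul_one] at this
    linarith
  refine ⟨Fin.cons 0 κ, Fin.strictMono_cons.2 ⟨hpos, hκ⟩, fun j => ?_⟩
  obtain rfl | ⟨i, rfl⟩ := j.eq_zero_or_eq_succ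
  · simpa using h0
  · have := (hz i).le
    simp only [Fin.cons_succ, Fin.val_succ, pow_succ]
    linarith

/-- Prepending index `0` gains one weak sign change in `M *ᵥ z`, which variation diminishing makes
strict in `z`. -/
theorem IsTotallyPositive.alternationNumber_lt {l n : ℕ}
    {M : Matrix (Fin (l + 1)) (Fin n) ℝ} (hM : IsTotallyPositive M) {ε : ℝ} (hε : ε ≠ 0)
    {z : Fin n → ℝ} (hz : z ≠ 0) (h0 : ε * (M *ᵥ z) 0 ≤ 0) :
    alternationNumber ε (M *ᵥ z) < alternationNumber (-ε) z :=
  (hM.hasStrictAlternation (neg_ne_zero.2 hε) hz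
    ((hasStrictAlternation_alternationNumber ε (M *ᵥ z)).cons_zero h0)).le_alternationNumber

theorem IsTotallyPositive.mulVec_ne_zero {n : ℕ} {M : Matrix (Fin n) (Fin n) ℝ}
    (hM : IsTotallyPositive M) {z : Fin n → ℝ} (hz : z ≠ 0) : M *ᵥ z ≠ 0 := fun h =>
  hz (eq_zero_of_mulVec_eq_zero (hM n id id strictMono_id strictMono_id).ne' h)

/-- Along a nonzero trajectory of a totally positive linear time-varying system, the first
coordinate eventually has a constant nonzero sign. -/
theorem eventually_sign_of_isTotallyPositive {n : ℕ}
    {M : ℕ → Matrix (Fin (n + 1)) (Fin (n + 1)) ℝ} (hM : ∀ j, IsTotallyPositive (M j))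
    {z : ℕ → Fin (n + 1) → ℝ} (hz : ∀ j, z (j + 1) = M j *ᵥ z j) (h0 : z 0 ≠ 0) :
    (∀ᶠ j in atTop, 0 < z j 0) ∨ ∀ᶠ j in atTop, z j 0 < 0 := by
  have hne : ∀ j, z j ≠ 0 := fun j => by
    induction j with
    | zero => exact h0
    | succ j ih => exact hz j ▸ (hM j).mulVec_ne_zero ih
  have hanti : ∀ ε : ℝ, ε ≠ 0 → Antitone fun j => alternationNumber ε (z j) := fun ε hε =>
    antitone_nat_of_succ_le fun j => hz j ▸ (hM j).alternationNumber_le hε (hne j)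
  obtain ⟨N₁, hN₁⟩ := WellFoundedLT.antitone_chain_condition (hanti 1 one_ne_zero)
  obtain ⟨N₂, hN₂⟩ := WellFoundedLT.antitone_chain_condition (hanti (-1) (by norm_num))
  -- Once both numbers are frozen, the two weak signs of the first coordinate force opposite strict
  -- inequalities between constants, so only one can ever occur.
  have hstep : ∀ j, N₁ ≤ j → N₂ ≤ j →
      (z (j + 1) 0 ≤ 0 → alternationNumber 1 (z N₁) < alternationNumber (-1) (z N₂)) ∧
      (0 ≤ z (j + 1) 0 → alternationNumber (-1) (z N₂) < alternationNumber 1 (z N₁)) := by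
    intro j h₁ h₂
    constructor
    · intro hle
      have := (hM j).alternationNumber_lt one_ne_zero (hne j) (by rw [← hz]; linarith)
      rwa [← hz, ← hN₁ (j + 1) (by omega), ← hN₂ j h₂] at this
    · intro hge
      have := (hM j).alternationNumber_lt (ε := -1) (by norm_num) (hne j)
        (by rw [← hz]; linarith)
      rwa [← hz, neg_neg, ← hN₁ j h₁, ← hN₂ (j + 1) (by omega)] at this
  by_cases hlt : alternationNumber (-1) (z N₂) < alternationNumber 1 (z N₁)
  · left
    filter_upwards [eventually_gt_atTop (N₁ + N₂)] with j hj
    obtain ⟨j, rfl⟩ : ∃ i, j = i + 1 := ⟨j - 1, by omega⟩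
    by_contra! hle
    exact ((hstep j (by omega) (by omega)).1 hle).not_gt hlt
  · right
    filter_upwards [eventually_gt_atTop (N₁ + N₂)] with j hj
    obtain ⟨j, rfl⟩ : ∃ i, j = i + 1 := ⟨j - 1, by omega⟩
    by_contra! hge
    exact hlt ((hstep j (by omega) (by omega)).2 hge)

/-! ### Solutions and their differences -/

/-- The value at time `k` of the solution that starts at `p`. -/
def trajectory {n : ℕ} (C : ℕ → Matrix (Fin n) (Fin n) ℝ) (f : Fin n → ℝ → ℝ) (p : Fin n → ℝ) :
    ℕ → Fin n → ℝ
  | 0 => p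
  | k + 1 => C k *ᵥ fun i => f i (trajectory C f p k i)

section Solutions

variable {n : ℕ} {C : ℕ → Matrix (Fin n) (Fin n) ℝ} {f : Fin n → ℝ → ℝ} {x y : ℕ → Fin n → ℝ}

theorem isSolution_trajectory (p : Fin n → ℝ) : IsSolution C f (trajectory C f p) := fun _ => rfl

theorem IsSolution.eq_trajectory (hx : IsSolution C f x) (k : ℕ) :
    x k = trajectory C f (x 0) k := by
  induction k with
  | zero => rfl
  | succ k ih => rw [hx k, trajectory, ← ih]

theorem IsSolution.shift (hx : IsSolution C f x) {N : ℕ} (hC : ∀ k, C (k + N) = C k) :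
    IsSolution C f fun k => x (k + N) := fun k => by
  change x (k + 1 + N) = C k *ᵥ _
  rw [add_right_comm, hx (k + N), hC]

theorem continuous_trajectory (hf : ∀ i, Continuous (f i)) (k : ℕ) :
    Continuous fun p => trajectory C f p k := by
  induction k with
  | zero => exact continuous_id
  | succ k ih =>
    exact continuous_const.matrix_mulVec
      (continuous_pi fun i => (hf i).comp ((continuous_apply i).comp ih))

/-- The difference of two solutions solves a linear system whose matrices are those of `C` with
columns rescaled by positive numbers. -/
theorem IsSolution.sub_eq_mulVec (hf : ∀ i, StrictMono (f i)) (hx : IsSolution C f x)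
    (hy : IsSolution C f y) :
    ∃ d : ℕ → Fin n → ℝ, (∀ k i, 0 < d k i) ∧
      ∀ k, x (k + 1) - y (k + 1) = (C k * diagonal (d k)) *ᵥ (x k - y k) := by
  -- `d` is the secant slope of `f i`; where the points coincide any positive value serves.
  have key : ∀ k i, ∃ d : ℝ, 0 < d ∧ f i (x k i) - f i (y k i) = d * (x k i - y k i) := by
    intro k i
    rcases lt_trichotomy (x k i) (y k i) with h | h | h
    · refine ⟨(f i (x k i) - f i (y k i)) / (x k i - y k i), div_pos_of_neg_of_neg
        (sub_neg.2 (hf i h)) (sub_neg.2 h), (div_mul_cancel₀ _ (sub_neg.2 h).ne).symm⟩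
    · exact ⟨1, one_pos, by simp [h]⟩
    · refine ⟨(f i (x k i) - f i (y k i)) / (x k i - y k i), div_pos
        (sub_pos.2 (hf i h)) (sub_pos.2 h), (div_mul_cancel₀ _ (sub_pos.2 h).ne').symm⟩
  choose d hd hfd using key
  refine ⟨d, hd, fun k => ?_⟩
  rw [hx k, hy k, ← mulVec_sub, ← mulVec_mulVec]
  congr 1
  ext i
  rw [mulVec_diagonal]
  exact hfd k i

end Solutions

/-- Sampled at multiples of the order of the ODTS, the first coordinates of two distinct solutions
are eventually strictly ordered. -/
theorem IsODTS.eventually_lt_or_gt {n : ℕ} {C : ℕ → Matrix (Fin (n + 1)) (Fin (n + 1)) ℝ}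
    {h : ℕ} (hC : IsODTS C h) {f : Fin (n + 1) → ℝ → ℝ} (hf : ∀ i, StrictMono (f i))
    {x y : ℕ → Fin (n + 1) → ℝ} (hx : IsSolution C f x) (hy : IsSolution C f y)
    (hxy : x 0 ≠ y 0) :
    (∀ᶠ j in atTop, y (h * j) 0 < x (h * j) 0) ∨ ∀ᶠ j in atTop, x (h * j) 0 < y (h * j) 0 := by
  obtain ⟨d, hd, hz⟩ := hx.sub_eq_mulVec hf hy
  have hM : ∀ j, IsTotallyPositive
      (List.ofFn fun i : Fin h => C (h * j + i) * diagonal (d (h * j + i))).reverse.prod :=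
    fun j => IsTotallyPositive.prod_mul_diagonal (fun i => C (h * j + i))
      (fun i => d (h * j + i)) (fun i => (hC.2.1 _).1) (fun i => hd _) h
      (hC.2.2 (fun i => h * j + i) fun a b hab => by simpa using hab)
  have := eventually_sign_of_isTotallyPositive hM (z := fun j => x (h * j) - y (h * j))
    (fun j => iterate_mulVec (fun i => C (h * j + i) * diagonal (d (h * j + i)))
      (fun i => x (h * j + i) - y (h * j + i)) (fun i => hz (h * j + i)) h)
    (sub_ne_zero.2 (by simpa using hxy))
  simpa using this

/-! ### Convergence to a periodic solution -/

/-- A sequence of reals that is eventually monotone and bounded above converges. -/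
theorem exists_tendsto_of_eventually_le_succ {a : ℕ → ℝ} (ha : BddAbove (Set.range a))
    (h : ∀ᶠ k in atTop, a k ≤ a (k + 1)) : ∃ c, Tendsto a atTop (𝓝 c) := by
  obtain ⟨K, hK⟩ := eventually_atTop.1 h
  have hmono : Monotone fun k => a (k + K) := monotone_nat_of_le_succ fun k => by
    have := hK (k + K) (by omega)
    rwa [add_right_comm] at this
  exact ⟨_, (tendsto_add_atTop_iff_nat K).1 (tendsto_atTop_ciSup hmono
    (ha.mono (Set.range_comp_subset_range (· + K) a)))⟩

theorem exists_tendsto_of_eventually_succ_le {a : ℕ → ℝ} (ha : BddBelow (Set.range a))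
    (h : ∀ᶠ k in atTop, a (k + 1) ≤ a k) : ∃ c, Tendsto a atTop (𝓝 c) := by
  obtain ⟨c, hc⟩ := exists_tendsto_of_eventually_le_succ (a := fun k => -a k)
    (by simpa [Set.range_comp'] using ha.neg) (h.mono fun k hk => neg_le_neg hk)
  exact ⟨-c, by simpa using hc.neg⟩

/-- If `x` approaches an `N`-periodic sequence along each residue class, it approaches it. -/
theorem tendsto_of_tendsto_residues {E : Type*} [TopologicalSpace E] {w : ℕ → E} {a : E} {N : ℕ}
    (hN : 0 < N) (h : ∀ r, r < N → Tendsto (fun k => w (r + N * k)) atTop (𝓝 a)) :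
    Tendsto w atTop (𝓝 a) := by
  intro s hs
  have hall : ∀ᶠ k in atTop, ∀ r ∈ Finset.range N, w (r + N * k) ∈ s :=
    (Finset.eventually_all _).2 fun r hr => h r (Finset.mem_range.1 hr) hs
  have hdiv : Tendsto (fun k : ℕ => k / N) atTop atTop := Nat.tendsto_div_const_atTop hN.ne'
  refine (hdiv.eventually hall).mono fun k hk => ?_
  have := hk (k % N) (Finset.mem_range.2 (Nat.mod_lt _ hN))
  rwa [Nat.mod_add_div] at this

theorem mainTheorem2 (n : ℕ) (f : Fin n → ℝ → ℝ) (C : ℕ → Matrix (Fin n) (Fin n) ℝ)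
    (Ω : Set (Fin n → ℝ)) (T h : ℕ)
    (hf : ∀ i, ContDiff ℝ 1 (f i)) (hf' : ∀ i y, 0 < deriv (f i) y)
    (hΩ : IsCompact Ω) (hΩconv : Convex ℝ Ω)
    (hinv : ∀ x, IsSolution C f x → x 0 ∈ Ω → ∀ k, x k ∈ Ω)
    (hT : 0 < T) (hC : ∀ k, C (k + T) = C k)
    (hODTS : IsODTS C h) :
    ∀ x, IsSolution C f x → x 0 ∈ Ω →
      ∃ y, IsSolution C f y ∧ (∀ k, y k ∈ Ω) ∧ (∀ k, y (k + h * T) = y k) ∧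
        Tendsto (fun k => x k - y k) atTop (𝓝 0) := by
  intro x hx hx0
  -- In dimension zero there is no first coordinate to compare.
  rcases n with _ | n
  · refine ⟨x, hx, hinv x hx hx0, fun k => Subsingleton.elim _ _, ?_⟩
    simp
  have hmono : ∀ i, StrictMono (f i) := fun i => strictMono_of_deriv_pos (hf' i)
  have hcont : ∀ k, Continuous fun p => trajectory C f p k :=
    continuous_trajectory fun i => (hf i).continuous
  set N := h * T with hN_def
  have hN : 0 < N := Nat.mul_pos hODTS.1 hT
  have hCT : ∀ m k, C (k + T * m) = C k := by
    intro m k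
    induction m with
    | zero => rfl
    | succ m ih => rw [Nat.mul_succ, ← add_assoc, hC, ih]
  have hCN : ∀ j k, C (k + N * j) = C k := fun j k => by
    rw [hN_def, mul_comm h T, mul_assoc, hCT]
  have hxΩ := hinv x hx hx0
  have hflow : ∀ r k, x (r + N * k) = trajectory C f (x (N * k)) r := fun r k => by
    simpa using (hx.shift (hCN k)).eq_trajectory r
  -- Orderings hold at times `h * j`; taking `j = T * k` gives the times `N * k`.
  have hsample : Tendsto (fun k : ℕ => T * k) atTop atTop :=
    tendsto_id.const_mul_atTop' hT
  have hbdd : Bornology.IsBounded (Set.range fun k => x (N * k) 0) :=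
    (hΩ.image (continuous_apply (0 : Fin (n + 1)))).isBounded.subset
      (Set.range_subset_iff.2 fun k => ⟨_, hxΩ _, rfl⟩)
  obtain ⟨c, hc⟩ : ∃ c, Tendsto (fun k => x (N * k) 0) atTop (𝓝 c) := by
    have hshift : IsSolution C f fun k => x (k + N) := hx.shift (by simpa using hCN 1)
    by_cases heq : x (0 + N) = x 0
    · refine ⟨x 0 0, tendsto_const_nhds.congr fun k => ?_⟩
      induction k with
      | zero => simp
      | succ k ih =>
        rw [Nat.mul_succ, ih, hx.eq_trajectory (N * k), ← heq]
        exact congrFun (hshift.eq_trajectory (N * k)).symm 0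
    · rcases hODTS.eventually_lt_or_gt hmono hshift hx heq with hlt | hgt
      · refine exists_tendsto_of_eventually_le_succ hbdd.bddAbove ?_
        filter_upwards [hsample.eventually hlt] with k hk
        rw [← mul_assoc] at hk
        exact hk.le
      · refine exists_tendsto_of_eventually_succ_le hbdd.bddBelow ?_
        filter_upwards [hsample.eventually hgt] with k hk
        rw [← mul_assoc] at hk
        exact hk.le
  -- The continuous flow over `j` periods sends `x (N * ψ k)` to `x (N * (j + ψ k))`, whose first
  -- coordinate tends to `c`.
  have hlimit : ∀ p, MapClusterPt p atTop (fun k => x (N * k)) →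
      ∀ j, trajectory C f p (N * j) 0 = c := by
    intro p hp j
    obtain ⟨ψ, hψ, hψp⟩ := hp.tendsto_subseq
    have h₁ : Tendsto (fun k => trajectory C f (x (N * ψ k)) (N * j) 0) atTop
        (𝓝 (trajectory C f p (N * j) 0)) :=
      (((continuous_apply 0).comp (hcont (N * j))).tendsto p).comp hψp
    refine tendsto_nhds_unique h₁ ?_
    have h₂ : Tendsto (fun k => j + ψ k) atTop atTop :=
      tendsto_atTop_mono (fun k => Nat.le_add_left _ _) hψ.tendsto_atTop
    refine (hc.comp h₂).congr fun k => ?_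
    simp only [Function.comp_apply]
    rw [← hflow, mul_add]
  have hunique : ∀ p q, MapClusterPt p atTop (fun k => x (N * k)) →
      MapClusterPt q atTop (fun k => x (N * k)) → p = q := by
    intro p q hp hq
    by_contra hne
    have heq : ∀ k, trajectory C f p (h * (T * k)) 0 = trajectory C f q (h * (T * k)) 0 :=
      fun k => by rw [← mul_assoc, ← hN_def, hlimit p hp, hlimit q hq]
    rcases hODTS.eventually_lt_or_gt hmono (isSolution_trajectory p) (isSolution_trajectory q) hne
      with hlt | hgt
    · obtain ⟨k, hk⟩ := (hsample.eventually hlt).exists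
      exact hk.ne' (heq k)
    · obtain ⟨k, hk⟩ := (hsample.eventually hgt).exists
      exact hk.ne (heq k)
  obtain ⟨p, hpΩ, hp⟩ := hΩ.exists_mapClusterPt_of_frequently (l := atTop)
    (f := fun k => x (N * k)) (Frequently.of_forall fun k => hxΩ _)
  have hup : Tendsto (fun k => x (N * k)) atTop (𝓝 p) :=
    hΩ.tendsto_nhds_of_unique_mapClusterPt (Eventually.of_forall fun k => hxΩ _)
      fun q _ hq => hunique q p hq hp
  have hrp : ∀ r, Tendsto (fun k => x (r + N * k)) atTop (𝓝 (trajectory C f p r)) := fun r =>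
    (((hcont r).tendsto p).comp hup).congr fun k => (hflow r k).symm
  have hfix : trajectory C f p N = p := by
    refine tendsto_nhds_unique (hrp N) ?_
    refine (hup.comp (tendsto_add_atTop_nat 1)).congr fun k => ?_
    simp only [Function.comp_apply]
    rw [mul_add, mul_one, add_comm N]
  have hy := isSolution_trajectory (C := C) (f := f) p
  have hperiod : ∀ k j, trajectory C f p (k + N * j) = trajectory C f p k := by
    intro k j
    induction j with
    | zero => rfl
    | succ j ih =>
      rw [Nat.mul_succ, ← add_assoc, ← ih]
      have := (hy.shift (N := N) (by simpa using hCN 1)).eq_trajectory (k + N * j)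
      simpa [hfix] using this
  refine ⟨trajectory C f p, hy, hinv _ hy hpΩ, fun k => by simpa using hperiod k 1, ?_⟩
  refine tendsto_of_tendsto_residues hN fun r _ => ?_
  simp only [hperiod]
  simpa using (hrp r).sub_const (trajectory C f p r)
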